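/- For every sample size $N\ge 1$ let $X_1,\dots,X_N$ be independent (not necessarily identically distributed) random variables with values in a measurable space $S$ (their laws, and the underlying probability space, may depend on $N$). Let the sample be partitioned into $k=k(N)$ disjoint groups $G_1,\dots,G_k$, of possibly different cardinalities $n_j=\operatorname{card}(G_j)$ with $\sum_{j=1}^k n_j=N$, by a scheme that does not depend on the data. For each $j\le k$ let $\bar\theta_j$ be a real-valued estimator that is a measurable function of the observations in $G_j$ only. Let $\theta_*\in\mathbb R$, let $\sigma^{(j)}_{n_j}>0$ ($j\le k$; these constants may also depend on $N$), and put $$g_j(n_j)=\sup_{t\in\mathbb R}\left|\mathbb P\left(\frac{\bar\theta_j-\theta_*}{\sigma^{(j)}_{n_j}}\le t\right)-\Phi(t)\right|,\qquad H_k=\left(\frac1k\sum_{j=1}^k\frac1{\sigma^{(j)}_{n_j}}\right)^{-1},$$ where $\Phi$ is the distribution function of the standard normal law $N(0,1)$. Let $\hat\theta^{(k)}$ be a sample median of $\bar\theta_1,\dots,\bar\theta_k$, that is, a (measurable) minimizer of $z\mapsto\sum_{j=1}^k|\bar\theta_j-z|$ over $z\in\mathbb R$. Assume that, as $N\to\infty$,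 $$k\to\infty,\qquad \max_{1\le j\le k}\sqrt k\,g_j(n_j)\to0,\qquad \max_{1\le j\le k}\frac{H_k}{\sigma^{(j)}_{n_j}\sqrt k}\to0 .$$ Then, as $N\to\infty$, $$\sqrt k\,\frac{\hat\theta^{(k)}-\theta_*}{H_k}\ \xrightarrow{d}\ N\left(0,\frac{\pi}{2}\right).$$ -/

import Mathlib

open MeasureTheory ProbabilityTheory Filter Topology

noncomputable section

/-- `m` is a sample median of `x 0, …, x (k - 1)`: a minimizer of `z ↦ ∑ j, |x j - z|` over `ℝ`.
For even `k` every point between the two middle order statistics qualifies. -/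
def IsSampleMedian {k : ℕ} (x : Fin k → ℝ) (m : ℝ) : Prop :=
  ∀ z : ℝ, ∑ j, |x j - m| ≤ ∑ j, |x j - z|

/-- The harmonic mean `((1 / k) * ∑ j, 1 / σ j)⁻¹`. -/
def harmonicMean {k : ℕ} (σ : Fin k → ℝ) : ℝ :=
  ((1 / (k : ℝ)) * ∑ j, 1 / σ j)⁻¹

/-- The uniform distance `sup_t |P(Y ≤ t) - Φ(t)|` between the distribution function of the
random variable `Y` and the standard normal distribution function `Φ`. -/
def normalApproxError {Ω : Type*} [MeasurableSpace Ω] (P : Measure Ω) (Y : Ω → ℝ) : ℝ :=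
  ⨆ t : ℝ, |P.real {ω | Y ω ≤ t} - cdf (gaussianReal 0 1) t|

/-- The local estimator attached to the group of indices `G`: the value of the statistic `T`
on the part of the sample `X` indexed by `G`. -/
def localEstimator {Ω S : Type*} {N : ℕ} (X : Fin N → Ω → S) (G : Finset (Fin N))
    (T : (G → S) → ℝ) (ω : Ω) : ℝ :=
  T (fun i => X i ω)

end

/-! Fix `x`, put `s = θstar + x * H / √k`, and let `R j = ±1` record whether the `j`-th local
estimator is `≤ s`. Up to ties, the median is `≤ s` exactly when `∑ j, R j ≥ 0`, so the problem
becomes a central limit theorem for independent signs.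

With `a j = H / (σ j * √k)`, the mean of `R j` is within `2 * g j` of `2Φ(x * a j) - 1`. Since `a j
→ 0` uniformly, this is about `2 * x * φ(0) * a j`, where `φ = Φ'`. The weights satisfy `∑ j, a j =
√k` (`sum_harmonicMean_div`), and `√k * g j → 0` uniformly, so the mean of `(∑ j, R j) / √k` tends
to `x√(2/π)` (`tendsto_sum_div_sqrt_of_hasDerivAt`).

The individual means vanish, so the variances tend to `1` and the limit law is `N(x√(2/π), 1)`
(`tendstoInDistribution_sum_sign`). Its mass on `[0, ∞)` is `Φ(x√(2/π))`, the distribution function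
of `N(0, π/2)` at `x` (`gaussianReal_Ici_zero_eq`). -/

/-! ### Independence of the local estimators -/

/-- Blocks of an independent family are independent. -/
theorem iIndepFun_sigma_blocks {Ω ι : Type*} [MeasurableSpace Ω] {P : Measure Ω}
    {κ : ι → Type*} {E : (i : ι) → κ i → Type*} [∀ i j, MeasurableSpace (E i j)]
    {X : (p : (i : ι) × κ i) → Ω → E p.1 p.2} (mX : ∀ p, Measurable (X p))
    (h : iIndepFun X P) :
    iIndepFun (fun i ω (j : κ i) => X ⟨i, j⟩ ω) P := by
  have := h.isProbabilityMeasure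
  have : ∀ i j, IsProbabilityMeasure (P.map (X ⟨i, j⟩)) :=
    fun i j => Measure.isProbabilityMeasure_map (mX _).aemeasurable
  have hcurry : (MeasurableEquiv.piCurry E) ∘ (fun ω p => X p ω) =
      fun ω i j => X ⟨i, j⟩ ω := by
    ext; simp [Sigma.curry]
  -- Independence says that the joint law is a product; currying turns a product over pairs into a
  -- product of products.
  rw [iIndepFun_iff_map_fun_eq_infinitePi_map (by fun_prop), ← hcurry,
    ← Measure.map_map (by fun_prop) (by fun_prop),
    (iIndepFun_iff_map_fun_eq_infinitePi_map mX).1 h,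
    Measure.infinitePi_map_piCurry (fun i j => P.map (X ⟨i, j⟩))]
  congrm Measure.infinitePi fun i => ?_
  have hi : iIndepFun (fun j : κ i => X ⟨i, j⟩) P :=
    h.precomp (g := fun j : κ i => (⟨i, j⟩ : (i : ι) × κ i)) sigma_mk_injective
  exact ((iIndepFun_iff_map_fun_eq_infinitePi_map (by fun_prop)).1 hi).symm

theorem measurable_localEstimator {Ω S : Type*} [MeasurableSpace Ω] [MeasurableSpace S] {N : ℕ}
    {X : Fin N → Ω → S} (hX : ∀ i, Measurable (X i)) {G : Finset (Fin N)} {T : (G → S) → ℝ}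
    (hT : Measurable T) : Measurable (localEstimator X G T) :=
  hT.comp (measurable_pi_iff.2 fun i => hX i)

theorem iIndepFun_localEstimator {Ω S : Type*} [MeasurableSpace Ω] [MeasurableSpace S]
    {P : Measure Ω} {N k : ℕ} {X : Fin N → Ω → S} (hX : ∀ i, Measurable (X i))
    (hindep : iIndepFun X P) {G : Fin k → Finset (Fin N)}
    (hG : Pairwise fun i j => Disjoint (G i) (G j)) {T : (j : Fin k) → (G j → S) → ℝ}
    (hT : ∀ j, Measurable (T j)) :
    iIndepFun (fun j => localEstimator X (G j) (T j)) P := by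
  have hinj : Function.Injective (fun p : (j : Fin k) × G j => (p.2 : Fin N)) := by
    rintro ⟨i, a, ha⟩ ⟨j, b, hb⟩ hab
    obtain rfl : a = b := hab
    obtain rfl : i = j := by
      by_contra hij
      exact Finset.disjoint_left.1 (hG hij) ha hb
    rfl
  have h := iIndepFun_sigma_blocks (κ := fun j => G j) (E := fun _ _ => S)
    (X := fun p => X p.2) (fun p => hX _) (hindep.precomp hinj)
  exact h.comp T hT

/-! ### Sample medians and sign counts -/

theorem IsSampleMedian.neg {k : ℕ} {x : Fin k → ℝ} {m : ℝ} (h : IsSampleMedian x m) :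
    IsSampleMedian (fun j => -x j) (-m) := by
  intro z
  convert h (-z) using 2 with j _ j _
  · rw [← abs_neg]; ring_nf
  · rw [← abs_neg]; ring_nf

/-- If the points that are `≤ s` are in the strict majority, then a sample median is `≤ s`. -/
theorem IsSampleMedian.le_of_sum_pos {k : ℕ} {x : Fin k → ℝ} {m s : ℝ}
    (h : IsSampleMedian x m) (hs : 0 < ∑ j, if x j ≤ s then (1 : ℝ) else -1) : m ≤ s := by
  by_contra! hlt
  -- Moving the centre from `m` down to `s` gains exactly `m - s` at each point `≤ s` and loses at
  -- most `m - s` at any other.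
  have hterm : ∀ j, |x j - s| + (m - s) * (if x j ≤ s then (1 : ℝ) else -1) ≤ |x j - m| := by
    intro j
    split_ifs with hj
    · rw [abs_of_nonpos (by linarith), abs_of_nonpos (by linarith)]; linarith
    · have := abs_sub_abs_le_abs_sub (x j - s) (x j - m)
      have h2 : |x j - s - (x j - m)| = m - s := by
        rw [show x j - s - (x j - m) = m - s by ring, abs_of_pos (by linarith)]
      linarith
  have hsum := Finset.sum_le_sum fun j (_ : j ∈ Finset.univ) => hterm j
  rw [Finset.sum_add_distrib, ← Finset.mul_sum] at hsum
  have := h s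
  have := mul_pos (sub_pos.2 hlt) hs
  linarith

/-- If a sample median is `≤ s`, then at least half of the points are `≤ s`. -/
theorem IsSampleMedian.sum_nonneg_of_le {k : ℕ} {x : Fin k → ℝ} {m s : ℝ}
    (h : IsSampleMedian x m) (hs : m ≤ s) :
    0 ≤ ∑ j, if x j ≤ s then (1 : ℝ) else -1 := by
  by_contra! hneg
  -- `s'` is the smallest data point above `s`, or `s + 1` if there is none. No point lies strictly
  -- between, so after reflection the strict majority above `s` forces `s' ≤ m`.
  obtain ⟨s', hss', hs'⟩ : ∃ s', s < s' ∧ ∀ j, s < x j → s' ≤ x j := by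
    by_cases hne : (Finset.univ.filter fun j => s < x j).Nonempty
    · obtain ⟨j₀, hj₀, hmin⟩ := Finset.exists_min_image _ x hne
      exact ⟨x j₀, (Finset.mem_filter.1 hj₀).2, fun j hj => hmin j (by simpa using hj)⟩
    · refine ⟨s + 1, by linarith, fun j hj => absurd ⟨j, by simpa using hj⟩ hne⟩
  have hpos : 0 < ∑ j, if -x j ≤ -s' then (1 : ℝ) else -1 := by
    rw [← neg_pos, ← Finset.sum_neg_distrib] at hneg
    refine hneg.trans_eq (Finset.sum_congr rfl fun j _ => ?_)
    by_cases hj : x j ≤ s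
    · rw [if_pos hj, if_neg (by linarith)]
    · rw [if_neg hj, if_pos (by linarith [hs' j (not_le.1 hj)]), neg_neg]
  have := h.neg.le_of_sum_pos hpos
  linarith

/-! ### Convergence in distribution from distribution functions -/

/-- Pointwise convergence of the distribution functions to that of an atomless law implies
convergence in distribution. -/
theorem tendstoInDistribution_of_tendsto_measureReal_Iic {Ω : ℕ → Type*}
    [∀ n, MeasurableSpace (Ω n)] {P : (n : ℕ) → Measure (Ω n)} [∀ n, IsProbabilityMeasure (P n)]
    {Y : (n : ℕ) → Ω n → ℝ} (hY : ∀ n, Measurable (Y n))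
    {ν : Measure ℝ} [IsProbabilityMeasure ν]
    (h : ∀ x : ℝ, Tendsto (fun n => (P n).real {ω | Y n ω ≤ x}) atTop (𝓝 (ν.real (Set.Iic x)))) :
    TendstoInDistribution Y atTop (id : ℝ → ℝ) P ν := by
  refine ⟨fun n => (hY n).aemeasurable, aemeasurable_id, ?_⟩
  refine (isPiSystem_Ioc (id : ℝ → ℝ) id).tendsto_probabilityMeasure_of_tendsto_of_mem
    ?_ ?_ ?_
  · rintro s ⟨a, b, _, rfl⟩
    exact measurableSet_Ioc
  · intro u hu x hx
    obtain ⟨ε, hε, hball⟩ := Metric.isOpen_iff.1 hu x hx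
    refine ⟨Set.Ioc (x - ε / 2) (x + ε / 2), ⟨_, _, by simp only [id]; linarith, rfl⟩,
      Ioc_mem_nhds (by linarith) (by linarith), fun y hy => hball ?_⟩
    rw [Metric.mem_ball, Real.dist_eq, abs_lt]
    constructor <;> linarith [hy.1, hy.2]
  · rintro s ⟨a, b, hab : a < b, rfl⟩
    have key : ∀ μ : Measure ℝ, IsProbabilityMeasure μ →
        μ.real (Set.Ioc a b) = μ.real (Set.Iic b) - μ.real (Set.Iic a) := by
      intro μ _
      rw [show Set.Ioc a b = Set.Iic b \ Set.Iic a by ext; simp [and_comm],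
        measureReal_sdiff (Set.Iic_subset_Iic.2 hab.le) measurableSet_Iic]
    rw [← NNReal.tendsto_coe]
    simp only [id]
    change Tendsto (fun n => ((P n).map (Y n)).real (Set.Ioc a b)) atTop
      (𝓝 ((ν.map id).real (Set.Ioc a b)))
    have hn : ∀ n x, ((P n).map (Y n)).real (Set.Iic x) = (P n).real {ω | Y n ω ≤ x} :=
      fun n x => map_measureReal_apply (hY n) measurableSet_Iic
    have hp : ∀ n, IsProbabilityMeasure ((P n).map (Y n)) :=
      fun n => Measure.isProbabilityMeasure_map (hY n).aemeasurable
    simp only [fun n => key _ (hp n), hn, Measure.map_id, key ν inferInstance]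
    exact (h b).sub (h a)

/-! ### Central limit theorem for random signs, by characteristic functions -/

/-- A triangular-array product `∏ (1 + z j)` tends to `exp w` when the row sums tend to `w` and
the row sums of squares are negligible. -/
theorem tendsto_prod_one_add_exp {ι : Type*} {l : Filter ι} {k : ι → ℕ}
    {z : (i : ι) → Fin (k i) → ℂ} {w : ℂ}
    (hsum : Tendsto (fun i => ∑ j, z i j) l (𝓝 w))
    (hsq : Tendsto (fun i => ∑ j, ‖z i j‖ ^ 2) l (𝓝 0)) :
    Tendsto (fun i => ∏ j, (1 + z i j)) l (𝓝 (Complex.exp w)) := by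
  have hsmall : ∀ᶠ i in l, ∀ j, ‖z i j‖ ≤ 1 / 2 := by
    filter_upwards [hsq.eventually (gt_mem_nhds (show (0 : ℝ) < 1 / 4 by norm_num))] with i hi j
    have := Finset.single_le_sum (f := fun j => ‖z i j‖ ^ 2) (fun j _ => sq_nonneg _)
      (Finset.mem_univ j)
    nlinarith [norm_nonneg (z i j)]
  -- `log (1 + z) - z` is at most `‖z‖ ^ 2` in norm once `‖z‖ ≤ 1 / 2`.
  have hdiff : Tendsto (fun i => ∑ j, Complex.log (1 + z i j) - ∑ j, z i j) l (𝓝 0) := by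
    refine squeeze_zero_norm' ?_ hsq
    filter_upwards [hsmall] with i hi
    rw [← Finset.sum_sub_distrib]
    refine (norm_sum_le _ _).trans (Finset.sum_le_sum fun j _ => ?_)
    refine (Complex.norm_log_one_add_sub_self_le (by linarith [hi j])).trans ?_
    have : (1 - ‖z i j‖)⁻¹ ≤ 2 := by
      rw [inv_le_comm₀ (by linarith [hi j]) two_pos]; linarith [hi j]
    nlinarith [sq_nonneg ‖z i j‖]
  have hlog : Tendsto (fun i => ∑ j, Complex.log (1 + z i j)) l (𝓝 w) := by
    simpa using hdiff.add hsum
  refine ((Complex.continuous_exp.tendsto w).comp hlog).congr' ?_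
  filter_upwards [hsmall] with i hi
  simp only [Function.comp, Complex.exp_sum]
  refine Finset.prod_congr rfl fun j _ => Complex.exp_log fun h => ?_
  have h1 : z i j = -1 := by linear_combination h
  have := hi j
  rw [h1] at this
  norm_num at this

/-- The characteristic function of a random sign. -/
theorem charFun_map_of_abs_eq_one {Ω : Type*} [MeasurableSpace Ω] {P : Measure Ω}
    [IsProbabilityMeasure P] {R : Ω → ℝ} (hR : Measurable R) (h1 : ∀ ω, |R ω| = 1) (t : ℝ) :
    charFun (P.map R) t = Real.cos t + (∫ ω, R ω ∂P : ℝ) * Real.sin t * Complex.I := by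
  rw [charFun_apply_real, integral_map hR.aemeasurable (by fun_prop)]
  have hpt : ∀ ω, Complex.exp (t * R ω * Complex.I) =
      Real.cos t + (R ω : ℂ) * (Real.sin t * Complex.I) := by
    intro ω
    rcases eq_or_eq_neg_of_abs_eq (h1 ω) with h | h
    · simp [h, Complex.exp_mul_I]
    · have : (t : ℂ) * ((-1 : ℝ) : ℂ) * Complex.I = (-(t : ℂ)) * Complex.I := by push_cast; ring
      rw [h, this, Complex.exp_mul_I]
      simp [Complex.cos_neg, Complex.sin_neg]
  have hint : Integrable R P :=
    Integrable.of_bound hR.aestronglyMeasurable 1 (ae_of_all _ fun ω => by simp [h1])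
  have hcast : ∫ ω, (R ω : ℂ) ∂P = ((∫ ω, R ω ∂P : ℝ) : ℂ) := integral_complex_ofReal
  simp_rw [hpt]
  rw [integral_add (integrable_const _) (hint.ofReal.mul_const _), integral_mul_const]
  erw [hcast]
  simp [mul_assoc]

theorem tendsto_mul_cos_sub_one {k : ℕ → ℕ} (hk : Tendsto k atTop atTop) (t : ℝ) :
    Tendsto (fun n => (k n : ℝ) * (Real.cos (t / √(k n)) - 1)) atTop (𝓝 (-(t ^ 2 / 2))) := by
  have hk' : Tendsto (fun n => (k n : ℝ)) atTop atTop := tendsto_natCast_atTop_atTop.comp hk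
  -- The factor `5 / 96` is the constant of `Real.cos_bound`.
  have hbound : Tendsto (fun n => t ^ 4 * (5 / 96) / (k n : ℝ)) atTop (𝓝 0) :=
    hk'.const_div_atTop _
  have hτ : Tendsto (fun n => |t / √(k n : ℝ)|) atTop (𝓝 0) := by
    simpa using ((Real.tendsto_sqrt_atTop.comp hk').const_div_atTop t).abs
  rw [tendsto_iff_norm_sub_tendsto_zero]
  refine squeeze_zero' (Eventually.of_forall fun _ => norm_nonneg _) ?_ hbound
  filter_upwards [hτ.eventually (gt_mem_nhds one_pos), hk'.eventually (eventually_gt_atTop 0)]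
    with n hn hpos
  have h4 := Real.cos_bound hn.le
  have hs : √(k n : ℝ) ^ 2 = k n := Real.sq_sqrt hpos.le
  have h2 : (t / √(k n : ℝ)) ^ 2 = t ^ 2 / k n := by rw [div_pow, hs]
  have h4' : |t / √(k n : ℝ)| ^ 4 = t ^ 4 / (k n) ^ 2 := by
    rw [show |t / √(k n : ℝ)| ^ 4 = ((t / √(k n : ℝ)) ^ 2) ^ 2 by
      rw [← sq_abs (t / √(k n : ℝ))]; ring, h2, div_pow, ← pow_mul]
  rw [h2, h4'] at h4
  have : (k n : ℝ) * (Real.cos (t / √(k n)) - 1) - -(t ^ 2 / 2) =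
      k n * (Real.cos (t / √(k n)) - (1 - t ^ 2 / k n / 2)) := by
    field_simp; ring
  rw [this, Real.norm_eq_abs, abs_mul, abs_of_pos hpos]
  calc _ ≤ (k n : ℝ) * (t ^ 4 / (k n) ^ 2 * (5 / 96)) := by gcongr
    _ = _ := by field_simp

theorem tendsto_sqrt_mul_sin {k : ℕ → ℕ} (hk : Tendsto k atTop atTop) (t : ℝ) :
    Tendsto (fun n => √(k n : ℝ) * Real.sin (t / √(k n))) atTop (𝓝 t) := by
  have hk' : Tendsto (fun n => √(k n : ℝ)) atTop atTop :=
    Real.tendsto_sqrt_atTop.comp (tendsto_natCast_atTop_atTop.comp hk)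
  have hd : HasDerivAt (fun x : ℝ => Real.sin (t * x)) t 0 := by
    have := (Real.hasDerivAt_sin (t * 0)).comp (0 : ℝ) ((hasDerivAt_id (0 : ℝ)).const_mul t)
    simpa [Function.comp_def] using this
  -- The expression is the difference quotient of `sin (t * x)` at `0` with increment `1 / √k`.
  have h := hd.tendsto_slope_zero_right.comp
    (tendsto_inv_atTop_nhdsGT_zero.comp hk')
  refine h.congr fun n => ?_
  simp [Function.comp, div_eq_mul_inv]

/-- Central limit theorem for triangular arrays of independent, almost balanced random signs. -/
theorem tendstoInDistribution_sum_sign {Ω : ℕ → Type*}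
    [∀ n, MeasurableSpace (Ω n)] {P : (n : ℕ) → Measure (Ω n)} [∀ n, IsProbabilityMeasure (P n)]
    {k : ℕ → ℕ} (hk : Tendsto k atTop atTop) {R : (n : ℕ) → Fin (k n) → Ω n → ℝ}
    (hR : ∀ n j, Measurable (R n j)) (h1 : ∀ n j ω, |R n j ω| = 1)
    (hind : ∀ n, iIndepFun (R n) (P n)) {e : ℕ → ℝ} (he : Tendsto e atTop (𝓝 0))
    (hRe : ∀ᶠ n in atTop, ∀ j, |∫ ω, R n j ω ∂(P n)| ≤ e n) {c : ℝ}
    (hc : Tendsto (fun n => (∑ j, ∫ ω, R n j ω ∂(P n)) / √(k n)) atTop (𝓝 c)) :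
    TendstoInDistribution (fun n ω => (√(k n : ℝ))⁻¹ * ∑ j, R n j ω) atTop (id : ℝ → ℝ) P
      (gaussianReal c 1) := by
  have hm : ∀ n, Measurable (fun ω => (√(k n : ℝ))⁻¹ * ∑ j, R n j ω) :=
    fun n => (Finset.measurable_sum _ fun j _ => hR n j).const_mul _
  refine ⟨fun n => (hm n).aemeasurable, aemeasurable_id, ?_⟩
  refine ProbabilityMeasure.tendsto_iff_tendsto_charFun.2 fun t => ?_
  set q : (n : ℕ) → Fin (k n) → ℝ := fun n j => ∫ ω, R n j ω ∂(P n) with hq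
  set z : (n : ℕ) → Fin (k n) → ℂ := fun n j =>
    ((Real.cos (t / √(k n)) - 1 : ℝ) : ℂ) + (q n j * Real.sin (t / √(k n)) : ℝ) * Complex.I with hz
  have hcf : ∀ n, charFun ((P n).map (fun ω => (√(k n : ℝ))⁻¹ * ∑ j, R n j ω)) t =
      ∏ j, (1 + z n j) := by
    intro n
    rw [charFun_map_mul_comp (Finset.measurable_sum _ fun j _ => hR n j).aemeasurable,
      (hind n).charFun_map_fun_sum_eq_prod fun j => (hR n j).aemeasurable, Finset.prod_apply]
    refine Finset.prod_congr rfl fun j _ => ?_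
    rw [charFun_map_of_abs_eq_one (hR n j) (h1 n j), inv_mul_eq_div]
    simp only [hz, hq]
    push_cast
    ring
  simp only [ProbabilityMeasure.coe_mk, hcf, Measure.map_id, charFun_gaussianReal]
  have hC := tendsto_mul_cos_sub_one hk t
  have hS := tendsto_sqrt_mul_sin hk t
  have hk' : Tendsto (fun n => (k n : ℝ)) atTop atTop := tendsto_natCast_atTop_atTop.comp hk
  have hsum : Tendsto (fun n => ∑ j, z n j) atTop
      (𝓝 (t * c * Complex.I - ((1 : NNReal) : ℝ) * t ^ 2 / 2)) := by
    have hre := (Complex.continuous_ofReal.tendsto _).comp hC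
    have him := (Complex.continuous_ofReal.tendsto _).comp (hc.mul hS)
    convert! (hre.add (him.mul_const Complex.I)).congr' ?_ using 2
    · push_cast; ring
    filter_upwards [hk'.eventually (eventually_gt_atTop 0)] with n hpos
    have : √(k n : ℝ) ≠ 0 := (Real.sqrt_pos.2 hpos).ne'
    have hval : (∑ j, q n j) / √(k n : ℝ) * (√(k n : ℝ) * Real.sin (t / √(k n))) =
        ∑ j, q n j * Real.sin (t / √(k n)) := by
      rw [← Finset.sum_mul]; field_simp
    simp only [Function.comp, hz, Finset.sum_add_distrib, ← Finset.sum_mul, Finset.sum_const,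
      Finset.card_univ, Fintype.card_fin, nsmul_eq_mul, ← Complex.ofReal_sum]
    rw [hval, Finset.sum_mul]
    push_cast
    rfl
  refine tendsto_prod_one_add_exp hsum ?_
  -- The bound is `k` times `(cos - 1) ^ 2 + e ^ 2 * sin ^ 2`, regrouped into the convergent
  -- quantities `k * (cos - 1)` and `√k * sin`.
  have hlim : Tendsto (fun n => ((k n : ℝ) * (Real.cos (t / √(k n)) - 1)) ^ 2 / k n +
      e n ^ 2 * (√(k n : ℝ) * Real.sin (t / √(k n))) ^ 2) atTop (𝓝 0) := by
    simpa using ((hC.pow 2).div_atTop hk').add ((he.pow 2).mul (hS.pow 2))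
  refine squeeze_zero' (Eventually.of_forall fun n => Finset.sum_nonneg fun _ _ => sq_nonneg _)
    ?_ hlim
  filter_upwards [hRe, hk'.eventually (eventually_gt_atTop 0)] with n hn hpos
  have hterm : ∀ j, ‖z n j‖ ^ 2 ≤ (Real.cos (t / √(k n)) - 1) ^ 2 +
      e n ^ 2 * Real.sin (t / √(k n)) ^ 2 := by
    intro j
    rw [← Complex.normSq_eq_norm_sq, hz, Complex.normSq_add_mul_I, mul_pow]
    have : q n j ^ 2 ≤ e n ^ 2 := sq_le_sq' (by linarith [abs_le.1 (hn j)]) (abs_le.1 (hn j)).2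
    gcongr
  refine (Finset.sum_le_sum fun j _ => hterm j).trans (le_of_eq ?_)
  rw [Finset.sum_const, Finset.card_univ, Fintype.card_fin, nsmul_eq_mul, mul_pow, mul_pow,
    Real.sq_sqrt hpos.le]
  field_simp

/-! ### Gaussian distribution function and its slope at zero -/

theorem continuous_gaussianPDFReal (μ : ℝ) (v : NNReal) : Continuous (gaussianPDFReal μ v) := by
  unfold gaussianPDFReal
  fun_prop

theorem hasDerivAt_cdf_gaussianReal (x : ℝ) :
    HasDerivAt (cdf (gaussianReal 0 1)) (gaussianPDFReal 0 1 x) x := by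
  have hint := integrable_gaussianPDFReal 0 1
  have heq : ∀ y, cdf (gaussianReal 0 1) y =
      cdf (gaussianReal 0 1) x + ∫ u in x..y, gaussianPDFReal 0 1 u := by
    have hI : ∀ y, cdf (gaussianReal 0 1) y = ∫ u in Set.Iic y, gaussianPDFReal 0 1 u := by
      intro y
      rw [cdf_eq_real, Measure.real, gaussianReal_apply_eq_integral 0 one_ne_zero,
        ENNReal.toReal_ofReal (integral_nonneg fun u => gaussianPDFReal_nonneg _ _ _)]
    intro y
    rw [hI, hI, ← intervalIntegral.integral_Iic_sub_Iic hint.integrableOn hint.integrableOn]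
    ring
  have hd := (intervalIntegral.integral_hasDerivAt_right (hint.intervalIntegrable (a := x) (b := x))
    (measurable_gaussianPDFReal 0 1).stronglyMeasurable.stronglyMeasurableAtFilter
    (continuous_gaussianPDFReal 0 1).continuousAt).const_add (cdf (gaussianReal 0 1) x)
  exact hd.congr_of_eventuallyEq (Eventually.of_forall heq)

theorem measureReal_gaussianReal_Ici (c : ℝ) {v : NNReal} (x : ℝ) :
    (gaussianReal c v).real (Set.Ici x) = (gaussianReal (-c) v).real (Set.Iic (-x)) := by
  rw [← gaussianReal_map_neg, map_measureReal_apply measurable_neg measurableSet_Iic]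
  congr 1
  ext; simp

theorem cdf_gaussianReal_zero : cdf (gaussianReal 0 1) 0 = 1 / 2 := by
  have h1 := measureReal_gaussianReal_Ici 0 (v := 1) 0
  have := nullSingletonClass_gaussianReal (μ := 0) (v := 1) one_ne_zero
  have h2 : (gaussianReal 0 1).real (Set.Iic 0)ᶜ = (gaussianReal 0 1).real (Set.Ici 0) := by
    rw [Set.compl_Iic]
    exact measureReal_congr Ioi_ae_eq_Ici
  rw [probReal_compl_eq_one_sub measurableSet_Iic, h1, neg_zero] at h2
  rw [cdf_eq_real]
  linarith

theorem gaussianPDFReal_zero_one_zero : gaussianPDFReal 0 1 0 = (√(2 * Real.pi))⁻¹ := by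
  simp [gaussianPDFReal]

/-- The probability that `N(x √(2/π), 1)` is nonnegative is the value at `x` of the distribution
function of `N(0, π/2)`. -/
theorem gaussianReal_Ici_zero_eq (x : ℝ) :
    (gaussianReal (2 * x * (√(2 * Real.pi))⁻¹) 1).real (Set.Ici 0) =
      (gaussianReal 0 (NNReal.pi / 2)).real (Set.Iic x) := by
  set a : ℝ := 2 * (√(2 * Real.pi))⁻¹ with ha
  have hpi := Real.pi_pos
  have hs : 0 < √(2 * Real.pi) := by positivity
  have hapos : 0 < a := by positivity
  -- `a = √(2/π)` is the factor that rescales variance `π / 2` to `1`.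
  have hvar : (.mk (a ^ 2) (sq_nonneg _) * (NNReal.pi / 2) : NNReal) = 1 := by
    rw [← NNReal.coe_inj]
    push_cast
    rw [NNReal.coe_real_pi]
    change a ^ 2 * (Real.pi / 2) = 1
    rw [ha, mul_pow, inv_pow, Real.sq_sqrt (by positivity)]
    field_simp
  have h1 := gaussianReal_map_const_mul (μ := 0) (v := NNReal.pi / 2) a
  rw [hvar, mul_zero] at h1
  have h2 : gaussianReal (-(2 * x * (√(2 * Real.pi))⁻¹)) 1 =
      (gaussianReal 0 (NNReal.pi / 2)).map (fun y => a * y - a * x) := by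
    have h3 := gaussianReal_map_sub_const (μ := 0) (v := 1) (a * x)
    rw [← h1, Measure.map_map (by fun_prop) (by fun_prop)] at h3
    rw [show -(2 * x * (√(2 * Real.pi))⁻¹) = 0 - a * x by rw [ha]; ring, ← h3]
    rfl
  rw [measureReal_gaussianReal_Ici, h2, neg_zero,
    map_measureReal_apply (by fun_prop) measurableSet_Iic]
  congr 1
  ext y
  simp only [Set.mem_preimage, Set.mem_Iic]
  rw [sub_nonpos, mul_le_mul_iff_right₀ hapos]

/-! ### Passing between probabilities, limits and sign means -/

theorem abs_measureReal_sub_cdf_le_normalApproxError {Ω : Type*} [MeasurableSpace Ω]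
    (P : Measure Ω) [IsProbabilityMeasure P] (Y : Ω → ℝ) (t : ℝ) :
    |P.real {ω | Y ω ≤ t} - cdf (gaussianReal 0 1) t| ≤ normalApproxError P Y := by
  refine le_ciSup (f := fun t => |P.real {ω | Y ω ≤ t} - cdf (gaussianReal 0 1) t|) ?_ t
  refine ⟨1, ?_⟩
  rintro _ ⟨t, rfl⟩
  have h1 : P.real {ω | Y ω ≤ t} ≤ 1 := measureReal_le_one
  have h2 : 0 ≤ P.real {ω | Y ω ≤ t} := measureReal_nonneg
  have h3 := cdf_nonneg (gaussianReal 0 1) t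
  have h4 := cdf_le_one (gaussianReal 0 1) t
  rw [abs_le]
  constructor <;> linarith

theorem tendsto_measureReal_of_tendstoInDistribution {Ω : ℕ → Type*}
    [∀ n, MeasurableSpace (Ω n)] {P : (n : ℕ) → Measure (Ω n)} [∀ n, IsProbabilityMeasure (P n)]
    {Y : (n : ℕ) → Ω n → ℝ} (hY : ∀ n, Measurable (Y n)) {ν : Measure ℝ} [IsProbabilityMeasure ν]
    (h : TendstoInDistribution Y atTop (id : ℝ → ℝ) P ν) {E : Set ℝ} (hE : MeasurableSet E)
    (hfr : ν (frontier E) = 0) :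
    Tendsto (fun n => (P n).real {ω | Y n ω ∈ E}) atTop (𝓝 (ν.real E)) := by
  have h' := ProbabilityMeasure.tendsto_measure_of_null_frontier_of_tendsto' h.tendsto
    (E := E) (by simpa using hfr)
  simp only [ProbabilityMeasure.coe_mk, Measure.map_id] at h'
  refine ((ENNReal.tendsto_toReal (measure_ne_top ν E)).comp h').congr fun n => ?_
  exact map_measureReal_apply (hY n) hE

theorem integral_ite_one_neg_one {Ω : Type*} [MeasurableSpace Ω] {P : Measure Ω}
    [IsProbabilityMeasure P] {Y : Ω → ℝ} (hY : Measurable Y) (s : ℝ) :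
    ∫ ω, (if Y ω ≤ s then (1 : ℝ) else -1) ∂P = 2 * P.real {ω | Y ω ≤ s} - 1 := by
  have hs : MeasurableSet {ω | Y ω ≤ s} := measurableSet_le hY measurable_const
  have : (fun ω => if Y ω ≤ s then (1 : ℝ) else -1) =
      fun ω => 2 * {ω | Y ω ≤ s}.indicator (fun _ => (1 : ℝ)) ω - 1 := by
    ext ω
    by_cases h : Y ω ≤ s <;> simp [h]; norm_num
  rw [this, integral_sub (((integrable_const _).indicator hs).const_mul _) (integrable_const _),
    integral_const_mul, integral_indicator_const _ hs]
  simp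

/-! ### Linearization of the means over a row -/

theorem exists_forall_abs_sub_mul_le {F : ℝ → ℝ} {D : ℝ} (hF : HasDerivAt F D 0) (hF0 : F 0 = 0)
    {η : ℝ} (hη : 0 < η) :
    ∃ δ > 0, ∀ u, 0 ≤ u → u < δ → |F u - D * u| ≤ η * u := by
  have h := (hasDerivAt_iff_isLittleO.1 hF).bound hη
  obtain ⟨δ, hδ, hball⟩ := Metric.eventually_nhds_iff.1 h
  refine ⟨δ, hδ, fun u hu0 hu => ?_⟩
  have := @hball u (by simpa [abs_of_nonneg hu0] using hu)
  simpa [hF0, abs_of_nonneg hu0, mul_comm] using this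

section RowAverages

variable {k : ℕ → ℕ} {a q : (n : ℕ) → Fin (k n) → ℝ} {A S : ℕ → ℝ} {F : ℝ → ℝ} {D : ℝ}

/-- Each `q j` differs from `D * a j` by at most `S / √k + (ε / 2) * a j`. As the row has `k` terms
and `∑ j, a j = √k`, the total error is at most `(S + ε / 2) * √k`. -/
theorem tendsto_sum_div_sqrt_of_hasDerivAt (hk : Tendsto k atTop atTop)
    (ha0 : ∀ n j, 0 ≤ a n j)
    (ha : ∀ n j, a n j ≤ A n) (hA : Tendsto A atTop (𝓝 0))
    (hasum : ∀ᶠ n in atTop, ∑ j, a n j = √(k n : ℝ))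
    (hq : ∀ n j, √(k n : ℝ) * |q n j - F (a n j)| ≤ S n) (hS : Tendsto S atTop (𝓝 0))
    (hF : HasDerivAt F D 0) (hF0 : F 0 = 0) :
    Tendsto (fun n => (∑ j, q n j) / √(k n : ℝ)) atTop (𝓝 D) := by
  rw [Metric.tendsto_nhds]
  intro ε hε
  obtain ⟨δ, hδ, hδF⟩ := exists_forall_abs_sub_mul_le hF hF0 (half_pos hε)
  filter_upwards [hA.eventually (gt_mem_nhds hδ), hS.eventually (gt_mem_nhds (half_pos hε)),
    hasum, hk.eventually_gt_atTop 0] with n hAn hSn hsum hkn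
  have hkpos : (0 : ℝ) < k n := by exact_mod_cast hkn
  have hs : 0 < √(k n : ℝ) := Real.sqrt_pos.2 hkpos
  have hss : √(k n : ℝ) * √(k n : ℝ) = k n := Real.mul_self_sqrt hkpos.le
  have hterm : ∀ j, |q n j - D * a n j| ≤ S n / √(k n : ℝ) + ε / 2 * a n j := by
    intro j
    have h1 : |q n j - F (a n j)| ≤ S n / √(k n : ℝ) := by
      rw [le_div_iff₀ hs, mul_comm]; exact hq n j
    have h2 := hδF (a n j) (ha0 n j) ((ha n j).trans_lt hAn)
    calc _ = |(q n j - F (a n j)) + (F (a n j) - D * a n j)| := by ring_nf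
      _ ≤ _ := (abs_add_le _ _).trans (add_le_add h1 h2)
  have hdiff : (∑ j, q n j) / √(k n : ℝ) - D = (∑ j, (q n j - D * a n j)) / √(k n : ℝ) := by
    rw [Finset.sum_sub_distrib, ← Finset.mul_sum, hsum]
    field_simp
  rw [Real.dist_eq, hdiff, abs_div, abs_of_pos hs, div_lt_iff₀ hs]
  calc |∑ j, (q n j - D * a n j)| ≤ ∑ j, (S n / √(k n : ℝ) + ε / 2 * a n j) :=
        (Finset.abs_sum_le_sum_abs _ _).trans (Finset.sum_le_sum fun j _ => hterm j)
    _ = (S n + ε / 2) * √(k n : ℝ) := by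
        rw [Finset.sum_add_distrib, ← Finset.mul_sum, hsum, Finset.sum_const, Finset.card_univ,
          Fintype.card_fin, nsmul_eq_mul]
        nth_rewrite 1 [← hss]
        field_simp
    _ < ε * √(k n : ℝ) := by
        gcongr; linarith

/-- Supplies the uniform smallness of the sign means required by the central limit theorem. -/
theorem eventually_abs_le_of_hasDerivAt (hk : Tendsto k atTop atTop)
    (ha0 : ∀ n j, 0 ≤ a n j)
    (ha : ∀ n j, a n j ≤ A n) (hA : Tendsto A atTop (𝓝 0))
    (hq : ∀ n j, √(k n : ℝ) * |q n j - F (a n j)| ≤ S n)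
    (hF : HasDerivAt F D 0) (hF0 : F 0 = 0) :
    ∀ᶠ n in atTop, ∀ j, |q n j| ≤ S n + (1 + |D|) * A n := by
  obtain ⟨δ, hδ, hδF⟩ := exists_forall_abs_sub_mul_le hF hF0 one_pos
  filter_upwards [hA.eventually (gt_mem_nhds hδ), hk.eventually_ge_atTop 1] with n hAn hkn j
  have hs : 1 ≤ √(k n : ℝ) := Real.one_le_sqrt.2 (by exact_mod_cast hkn)
  have h1 : |q n j - F (a n j)| ≤ S n :=
    (le_mul_of_one_le_left (abs_nonneg _) hs).trans (hq n j)
  have h2 := hδF (a n j) (ha0 n j) ((ha n j).trans_lt hAn)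
  have h3 : |D * a n j| = |D| * a n j := by rw [abs_mul, abs_of_nonneg (ha0 n j)]
  have h4 : (1 + |D|) * a n j ≤ (1 + |D|) * A n := by
    have := ha n j
    gcongr
  calc |q n j| = |(q n j - F (a n j)) + (F (a n j) - D * a n j) + D * a n j| := by ring_nf
    _ ≤ _ := abs_add_three _ _ _
    _ ≤ _ := by linarith

end RowAverages

/-! ### Harmonic mean normalization -/

theorem harmonicMean_nonneg {k : ℕ} {σ : Fin k → ℝ} (hσ : ∀ j, 0 < σ j) : 0 ≤ harmonicMean σ :=
  inv_nonneg.2 (mul_nonneg (by positivity)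
    (Finset.sum_nonneg fun j _ => (one_div_pos.2 (hσ j)).le))

theorem sum_one_div_pos {k : ℕ} {σ : Fin k → ℝ} (hσ : ∀ j, 0 < σ j) (hk : 0 < k) :
    0 < ∑ j, 1 / σ j :=
  Finset.sum_pos (fun j _ => one_div_pos.2 (hσ j)) ⟨⟨0, hk⟩, Finset.mem_univ _⟩

theorem harmonicMean_pos {k : ℕ} {σ : Fin k → ℝ} (hσ : ∀ j, 0 < σ j) (hk : 0 < k) :
    0 < harmonicMean σ :=
  inv_pos.2 (mul_pos (one_div_pos.2 (by exact_mod_cast hk)) (sum_one_div_pos hσ hk))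

/-- This is why the harmonic mean is the right scale: the limiting drift does not depend on the
individual `σ j`. -/
theorem sum_harmonicMean_div {k : ℕ} {σ : Fin k → ℝ} (hσ : ∀ j, 0 < σ j) (hk : 0 < k) :
    ∑ j, harmonicMean σ / (σ j * √(k : ℝ)) = √(k : ℝ) := by
  have hkpos : (0 : ℝ) < k := by exact_mod_cast hk
  have hs : 0 < √(k : ℝ) := Real.sqrt_pos.2 hkpos
  have hsum := sum_one_div_pos hσ hk
  have : ∀ j, harmonicMean σ / (σ j * √(k : ℝ)) = harmonicMean σ / √(k : ℝ) * (1 / σ j) := by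
    intro j
    have := hσ j
    field_simp
  simp_rw [this]
  rw [← Finset.mul_sum, harmonicMean]
  have hss : (k : ℝ) = √(k : ℝ) * √(k : ℝ) := (Real.mul_self_sqrt hkpos.le).symm
  generalize ∑ j, 1 / σ j = s at hsum ⊢
  rw [div_mul_eq_mul_div, div_eq_iff hs.ne', ← hss]
  field_simp

/-! ### Asymptotic normality of the median -/

theorem theorem6
    {S : Type*} [MeasurableSpace S]
    -- for every sample size `N`: a probability space and an independent sample `X₁, …, X_N` in `S`
    {Ω : ℕ → Type*} [∀ N, MeasurableSpace (Ω N)]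
    (P : (N : ℕ) → Measure (Ω N)) [∀ N, IsProbabilityMeasure (P N)]
    (X : (N : ℕ) → Fin N → Ω N → S)
    (hX_meas : ∀ N i, Measurable (X N i))
    (hX_indep : ∀ N, iIndepFun (X N) (P N))
    -- a partition of the sample into `k = k N` groups
    (k : ℕ → ℕ)
    (G : (N : ℕ) → Fin (k N) → Finset (Fin N))
    (hG_disj : ∀ N, Pairwise fun i j => Disjoint (G N i) (G N j))
    (hG_cover : ∀ N, ∀ i : Fin N, ∃ j, i ∈ G N j)
    -- the statistics that produce the local estimators, and the parameter
    (T : (N : ℕ) → (j : Fin (k N)) → (G N j → S) → ℝ)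
    (hT : ∀ N j, Measurable (T N j))
    (θstar : ℝ)
    -- the normalizing constants: `σ N j` is the one of group `j` at sample size `N`
    (σ : (N : ℕ) → Fin (k N) → ℝ)
    (hσ : ∀ N j, 0 < σ N j)
    -- the global estimator is a median of the local estimators
    (θhat : (N : ℕ) → Ω N → ℝ)
    (hθhat_meas : ∀ N, Measurable (θhat N))
    (hθhat : ∀ N ω, IsSampleMedian (fun j => localEstimator (X N) (G N j) (T N j) ω) (θhat N ω))
    -- growth conditions
    (hk : Tendsto k atTop atTop)
    (hg : Tendsto
      (fun N => ⨆ j : Fin (k N), √(k N : ℝ) * normalApproxError (P N)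
        (fun ω => (localEstimator (X N) (G N j) (T N j) ω - θstar) / σ N j))
      atTop (𝓝 0))
    (hH : Tendsto
      (fun N => ⨆ j : Fin (k N), harmonicMean (σ N) / (σ N j * √(k N : ℝ)))
      atTop (𝓝 0)) :
    TendstoInDistribution
      (fun N ω => √(k N : ℝ) * ((θhat N ω - θstar) / harmonicMean (σ N)))
      atTop (id : ℝ → ℝ) P (gaussianReal 0 (NNReal.pi / 2)) := by
  refine tendstoInDistribution_of_tendsto_measureReal_Iic
    (fun N => (((hθhat_meas N).sub_const _).div_const _).const_mul _) fun x => ?_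
  set Y : (N : ℕ) → Fin (k N) → Ω N → ℝ := fun N j => localEstimator (X N) (G N j) (T N j) with hY
  have hYm : ∀ N j, Measurable (Y N j) := fun N j =>
    measurable_localEstimator (hX_meas N) (hT N j)
  have hYind : ∀ N, iIndepFun (Y N) (P N) := fun N =>
    iIndepFun_localEstimator (hX_meas N) (hX_indep N) (hG_disj N) (hT N)
  set s : ℕ → ℝ := fun N => θstar + x * harmonicMean (σ N) / √(k N : ℝ) with hs
  set R : (N : ℕ) → Fin (k N) → Ω N → ℝ := fun N j ω => if Y N j ω ≤ s N then 1 else -1 with hR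
  have hRm : ∀ N j, Measurable (R N j) := fun N j =>
    Measurable.ite (measurableSet_le (hYm N j) measurable_const) measurable_const measurable_const
  have hRind : ∀ N, iIndepFun (R N) (P N) := fun N =>
    (hYind N).comp (fun _ y => if y ≤ s N then (1 : ℝ) else -1)
      fun _ => Measurable.ite measurableSet_Iic measurable_const measurable_const
  have hR1 : ∀ N j ω, |R N j ω| = 1 := by
    intro N j ω
    simp only [hR]
    split_ifs <;> simp
  set a : (N : ℕ) → Fin (k N) → ℝ :=
    fun N j => harmonicMean (σ N) / (σ N j * √(k N : ℝ)) with ha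
  have ha0 : ∀ N j, 0 ≤ a N j := fun N j =>
    div_nonneg (harmonicMean_nonneg (hσ N)) (mul_nonneg (hσ N j).le (Real.sqrt_nonneg _))
  have haA : ∀ N j, a N j ≤ ⨆ j, a N j := fun N j => le_ciSup (Set.finite_range _).bddAbove j
  have hasum : ∀ᶠ N in atTop, ∑ j, a N j = √(k N : ℝ) := by
    filter_upwards [hk.eventually_gt_atTop 0] with N hN
    exact sum_harmonicMean_div (hσ N) hN
  -- `F (a N j)` is the mean that `R N j` would have if the local estimator were exactly normal.
  set F : ℝ → ℝ := fun u => 2 * cdf (gaussianReal 0 1) (x * u) - 1 with hF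
  have hF0 : F 0 = 0 := by simp [hF, cdf_gaussianReal_zero]
  have hFd : HasDerivAt F (2 * x * (√(2 * Real.pi))⁻¹) 0 := by
    have h0 : HasDerivAt (cdf (gaussianReal 0 1)) (√(2 * Real.pi))⁻¹ (x * 0) := by
      rw [mul_zero, ← gaussianPDFReal_zero_one_zero]
      exact hasDerivAt_cdf_gaussianReal 0
    convert! ((h0.comp (0 : ℝ) ((hasDerivAt_id (0 : ℝ)).const_mul x)).const_mul 2).sub_const 1
      using 1
    ring
  have hRF : ∀ N j, √(k N : ℝ) * |∫ ω, R N j ω ∂(P N) - F (a N j)| ≤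
      2 * ⨆ j : Fin (k N), √(k N : ℝ) * normalApproxError (P N)
        (fun ω => (Y N j ω - θstar) / σ N j) := by
    intro N j
    have hset : {ω | Y N j ω ≤ s N} = {ω | (Y N j ω - θstar) / σ N j ≤ x * a N j} := by
      ext ω
      have hσj := hσ N j
      have : x * a N j * σ N j = x * harmonicMean (σ N) / √(k N : ℝ) := by
        simp only [ha]
        field_simp
      simp only [Set.mem_ofPred_eq, hs]
      rw [div_le_iff₀ hσj, this, sub_le_iff_le_add']
    have hsup := le_ciSup (f := fun j : Fin (k N) => √(k N : ℝ) * normalApproxError (P N)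
        (fun ω => (Y N j ω - θstar) / σ N j)) (Set.finite_range _).bddAbove j
    have herr := abs_measureReal_sub_cdf_le_normalApproxError (P N)
      (fun ω => (Y N j ω - θstar) / σ N j) (x * a N j)
    have hval : |∫ ω, R N j ω ∂(P N) - F (a N j)| = 2 * |(P N).real
        {ω | (Y N j ω - θstar) / σ N j ≤ x * a N j} - cdf (gaussianReal 0 1) (x * a N j)| := by
      rw [show ∫ ω, R N j ω ∂(P N) = 2 * (P N).real {ω | Y N j ω ≤ s N} - 1 from
        integral_ite_one_neg_one (hYm N j) (s N), hset, ← abs_two, ← abs_mul, abs_two]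
      congr 1
      simp only [hF]
      ring
    rw [hval]
    have := mul_le_mul_of_nonneg_left herr (Real.sqrt_nonneg (k N : ℝ))
    linarith
  have hg2 := hg.const_mul 2
  rw [mul_zero] at hg2
  have hmean := tendsto_sum_div_sqrt_of_hasDerivAt hk ha0 haA hH hasum hRF hg2 hFd hF0
  have hsmall := eventually_abs_le_of_hasDerivAt hk ha0 haA hH hRF hFd hF0
  have he := hg2.add (hH.const_mul (1 + |2 * x * (√(2 * Real.pi))⁻¹|))
  rw [mul_zero, add_zero] at he
  have hclt := tendstoInDistribution_sum_sign hk hRm hR1 hRind he hsmall hmean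
  have := nullSingletonClass_gaussianReal (μ := 2 * x * (√(2 * Real.pi))⁻¹) one_ne_zero
  have hZm : ∀ N, Measurable fun ω => (√(k N : ℝ))⁻¹ * ∑ j, R N j ω :=
    fun N => (Finset.measurable_sum _ fun j _ => hRm N j).const_mul _
  -- `∑ R > 0` implies that the median is `≤ s`, which implies `∑ R ≥ 0`. The Gaussian limit has no
  -- atom at `0`, so both outer events have the same limiting probability, whichever median is
  -- chosen.
  have hup := tendsto_measureReal_of_tendstoInDistribution hZm hclt (E := Set.Ici 0)
    measurableSet_Ici (by rw [frontier_Ici]; exact measure_singleton 0)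
  have hlo := tendsto_measureReal_of_tendstoInDistribution hZm hclt (E := Set.Ioi 0)
    measurableSet_Ioi (by rw [frontier_Ioi]; exact measure_singleton 0)
  rw [measureReal_congr Ioi_ae_eq_Ici] at hlo
  rw [gaussianReal_Ici_zero_eq] at hup hlo
  refine tendsto_of_tendsto_of_tendsto_of_le_of_le' hlo hup ?_ ?_
  all_goals
    filter_upwards [hk.eventually_gt_atTop 0] with N hN
    have hsq : 0 < √(k N : ℝ) := Real.sqrt_pos.2 (by exact_mod_cast hN)
    have hHp := harmonicMean_pos (hσ N) hN
    have hiff : ∀ ω, √(k N : ℝ) * ((θhat N ω - θstar) / harmonicMean (σ N)) ≤ x ↔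
        θhat N ω ≤ s N := by
      intro ω
      simp only [hs]
      rw [← sub_le_iff_le_add', le_div_iff₀ hsq, ← mul_div_assoc, div_le_iff₀ hHp, mul_comm]
    refine measureReal_mono fun ω hω => ?_
    simp only [Set.mem_ofPred_eq, Set.mem_Ici, Set.mem_Ioi, hiff] at hω ⊢
  · exact (hθhat N ω).le_of_sum_pos (pos_of_mul_pos_right hω (inv_nonneg.2 hsq.le))
  · exact mul_nonneg (inv_nonneg.2 hsq.le) ((hθhat N ω).sum_nonneg_of_le hω)
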